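/- A lattice-ordered group is a group $X$ equipped with a lattice structure such that $x(y\vee z)=xy\vee xz$ and $(x\vee y)z=xz\vee yz$ for all $x,y,z\in X$; morphisms of lattice-ordered groups are the group homomorphisms preserving binary joins. Let $\ell\mathbb{G}rp$ be the category so obtained; it is semi-abelian. An ideal (normal subobject) of $X$ is a subobject of $X$ which is the kernel of some morphism. Two subobjects $a\colon A\rightarrowtail Y$, $b\colon B\rightarrowtail Y$ cooperate if there is a morphism $\varphi\colon A\times B\to Y$ with $\varphi\circ(\mathrm{id}_A,0)=a$ and $\varphi\circ(0,\mathrm{id}_B)=b$. The Huq commutator $[A,B]_X$ of two subobjects $A,B$ of $X$ is the smallest normal subobject $N$ of $X$ such that the images of $A$ and $B$ in $X/N$ cooperate. The Higgins commutator $[A,B]$ of two subobjects $a\colon A\rightarrowtail X$, $b\colon B\rightarrowtail X$ is the subobject of $X$ obtained as the image, in the sense of the (regular epimorphism, monomorphism)-factorization, of the composite $A\diamond B\to A+B\xrightarrow{[a,b]}X$, where $A\diamond B\to A+B$ is the kernel of the canonical morphism $A+B\to A\times B$ from the coproduct to the product. Then: (1) for every lattice-ordered group $X$ and all ideals $H,K$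 of $X$, the Huq commutator $[H,K]_X$ exists and equals the intersection $H\cap K$; (2) the category $\ell\mathbb{G}rp$ satisfies the condition (NH) of normality of Higgins commutators: for every lattice-ordered group $X$ and all normal subobjects $H,K$ of $X$, the Higgins commutator $[H,K]$ is a normal subobject of $X$. -/

import Mathlib

open CategoryTheory CategoryTheory.Limits

universe v u

/-! ### Normal subobjects, commutators and semi-abelian categories -/

namespace CategoryTheory

section Commutators

variable {C : Type u} [Category.{v} C] [HasZeroMorphisms C]

/-- An ideal (normal subobject) of `X`: a subobject which is the kernel of some morphism. -/
def IsIdeal {X : C} (A : Subobject X) : Prop :=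
  Nonempty (NormalMono A.arrow)

/-- Two subobjects of `X` cooperate (commute in the sense of Huq) if there is a morphism
`φ : A × B ⟶ X` restricting to the two inclusions along `(id, 0)` and `(0, id)`. -/
def Cooperate [HasBinaryProducts C] {X : C} (A B : Subobject X) : Prop :=
  ∃ φ : (A : C) ⨯ (B : C) ⟶ X,
    prod.lift (𝟙 (A : C)) 0 ≫ φ = A.arrow ∧ prod.lift 0 (𝟙 (B : C)) ≫ φ = B.arrow

/-- The images of `A` and `B` in the quotient `X / N` cooperate. -/
def CooperateModulo [HasBinaryProducts C] [HasImages C] [HasCokernels C] {X : C}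
    (A B N : Subobject X) : Prop :=
  Cooperate (imageSubobject (A.arrow ≫ cokernel.π N.arrow))
    (imageSubobject (B.arrow ≫ cokernel.π N.arrow))

/-- `N` is the Huq commutator `[A, B]_X`: the smallest normal subobject of `X` such that the
images of `A` and `B` cooperate in `X / N`. -/
def IsHuqCommutator [HasBinaryProducts C] [HasImages C] [HasCokernels C] {X : C}
    (A B N : Subobject X) : Prop :=
  IsLeast {M : Subobject X | IsIdeal M ∧ CooperateModulo A B M} N

/-- The canonical morphism `Σ : H + K ⟶ H × K`. -/
noncomputable def coprodToProd [HasBinaryProducts C] [HasBinaryCoproducts C] (H K : C) :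
    H ⨿ K ⟶ H ⨯ K :=
  coprod.desc (prod.lift (𝟙 H) 0) (prod.lift 0 (𝟙 K))

/-- The Higgins commutator `[A, B]`: the image of the cosmash product `A ⋄ B` (the kernel of
`Σ : A + B ⟶ A × B`) under the morphism `A + B ⟶ X` induced by the inclusions. -/
noncomputable def higginsCommutator [HasBinaryProducts C] [HasBinaryCoproducts C] [HasKernels C]
    [HasImages C] {X : C} (A B : Subobject X) : Subobject X :=
  imageSubobject (kernel.ι (coprodToProd (A : C) (B : C)) ≫ coprod.desc A.arrow B.arrow)

variable (C) in
/-- Semi-abelian categories: pointed, Barr-exact, with finite coproducts, and protomodular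
(for pointed categories with finite limits: the Split Short Five Lemma holds). -/
class SemiAbelian : Prop extends Regular C where
  hasZeroObject : HasZeroObject C
  hasFiniteCoproducts : HasFiniteCoproducts C
  isKernelPair_of_isEquivalenceRelation {R X : C} (p₁ p₂ : R ⟶ X) :
    IsEquivalenceRelation p₁ p₂ → ∃ (Y : C) (f : X ⟶ Y), IsKernelPair f p₁ p₂
  splitShortFive {A B A' B' : C} (p : A ⟶ B) (s : B ⟶ A) (p' : A' ⟶ B') (s' : B' ⟶ A')
    (u : A ⟶ A') (v : B ⟶ B') (_ : s ≫ p = 𝟙 B) (_ : s' ≫ p' = 𝟙 B')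
    (hp : p ≫ v = u ≫ p') (_ : s ≫ u = v ≫ s') :
    IsIso (kernel.map p p' u v hp) → IsIso v → IsIso u

instance (priority := 50) [SemiAbelian C] : HasFiniteCoproducts C :=
  SemiAbelian.hasFiniteCoproducts

variable (C) in
/-- The condition (NH) of normality of Higgins commutators for a semi-abelian category. In a
regular category the image used in `higginsCommutator` is given by the
(regular epimorphism, monomorphism)-factorization. -/
def NormalityOfHigginsCommutators [SemiAbelian C] : Prop :=
  ∀ (X : C) (H K : Subobject X), IsIdeal H → IsIdeal K → IsIdeal (higginsCommutator H K)

end Commutators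

end CategoryTheory

/-! ### The category of lattice-ordered groups -/

/-- Lattice-ordered groups. Monotonicity of left and right translations is equivalent to
distributivity of the product over binary joins. -/
structure LGrp : Type (u + 1) where
  carrier : Type u
  [group : Group carrier]
  [lattice : Lattice carrier]
  [mulLeftMono : MulLeftMono carrier]
  [mulRightMono : MulRightMono carrier]

attribute [instance] LGrp.group LGrp.lattice LGrp.mulLeftMono LGrp.mulRightMono

/-- Morphisms of lattice-ordered groups: group homomorphisms preserving binary joins. -/
structure LGrpHom (X Y : Type*) [Group X] [Lattice X] [Group Y] [Lattice Y] extends X →* Y where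
  map_sup' : ∀ a b : X, toFun (a ⊔ b) = toFun a ⊔ toFun b

namespace LGrpHom

variable {X Y Z : Type*} [Group X] [Lattice X] [Group Y] [Lattice Y] [Group Z] [Lattice Z]

instance : FunLike (LGrpHom X Y) X Y where
  coe f := f.toFun
  coe_injective f g h := by
    obtain ⟨f, _⟩ := f
    obtain ⟨g, _⟩ := g
    congr
    exact DFunLike.coe_injective h

instance : MonoidHomClass (LGrpHom X Y) X Y where
  map_mul f := f.map_mul'
  map_one f := f.map_one'

instance : SupHomClass (LGrpHom X Y) X Y where
  map_sup f := f.map_sup'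

/-- Build a morphism from preservation of products and joins. -/
def mk'' (f : X → Y) (hm : ∀ a b, f (a * b) = f a * f b) (hs : ∀ a b, f (a ⊔ b) = f a ⊔ f b) :
    LGrpHom X Y :=
  { MonoidHom.mk' f hm with map_sup' := hs }

@[simp] lemma mk''_apply (f : X → Y) (hm hs) (x : X) : mk'' f hm hs x = f x := rfl

@[ext] lemma ext {f g : LGrpHom X Y} (h : ∀ x, f x = g x) : f = g := DFunLike.ext _ _ h

/-- The identity morphism. -/
def id (X : Type*) [Group X] [Lattice X] : LGrpHom X X :=
  mk'' (fun x => x) (fun _ _ => rfl) (fun _ _ => rfl)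

/-- Composition of morphisms. -/
def comp (g : LGrpHom Y Z) (f : LGrpHom X Y) : LGrpHom X Z :=
  mk'' (fun x => g (f x)) (fun a b => by simp) (fun a b => by simp)

/-- Morphisms of lattice-ordered groups preserve binary meets. -/
lemma map_inf [MulLeftMono X] [MulRightMono X] [MulLeftMono Y] [MulRightMono Y]
    (f : LGrpHom X Y) (a b : X) : f (a ⊓ b) = f a ⊓ f b := by
  have h : ∀ {W : Type _} [Group W] [Lattice W] [MulLeftMono W] [MulRightMono W] (x y : W),
      x ⊓ y = (x⁻¹ ⊔ y⁻¹)⁻¹ := by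
    intro W _ _ _ _ x y
    rw [inv_sup, inv_inv, inv_inv]
  have h' : f a ⊓ f b = ((f a)⁻¹ ⊔ (f b)⁻¹)⁻¹ := by
    rw [inv_sup, inv_inv, inv_inv]
  rw [h, h', map_inv, map_sup, map_inv, map_inv]

end LGrpHom

namespace LGrp

instance : CoeSort LGrp (Type u) := ⟨LGrp.carrier⟩

instance : Category LGrp.{u} where
  Hom X Y := LGrpHom X Y
  id X := LGrpHom.id X
  comp f g := LGrpHom.comp g f

instance : ConcreteCategory LGrp.{u} (fun X Y => LGrpHom X Y) where
  hom f := f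
  ofHom f := f
  id_apply _ := rfl
  comp_apply _ _ _ := rfl

@[ext] lemma hom_ext {X Y : LGrp.{u}} {f g : X ⟶ Y} (h : ∀ x : X, f x = g x) : f = g :=
  ConcreteCategory.hom_ext _ _ h

/-- Build a morphism of the category from preservation of products and joins. -/
def mkHom {X Y : LGrp.{u}} (f : X → Y) (hm : ∀ a b, f (a * b) = f a * f b)
    (hs : ∀ a b, f (a ⊔ b) = f a ⊔ f b) : X ⟶ Y :=
  LGrpHom.mk'' f hm hs

@[simp] lemma mkHom_apply {X Y : LGrp.{u}} (f : X → Y) (hm hs) (x : X) :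
    mkHom f hm hs x = f x := rfl

instance : HasZeroMorphisms LGrp.{u} where
  zero X Y := ⟨mkHom (fun _ => 1) (fun _ _ => by simp) (fun _ _ => by simp)⟩
  comp_zero _ _ := rfl
  zero_comp _ _ _ f := hom_ext fun _ => map_one f.toMonoidHom

@[simp] lemma zero_apply {X Y : LGrp.{u}} (x : X) : (0 : X ⟶ Y) x = 1 := rfl

/-! #### Constructing lattice-ordered groups from operations and equations -/

/-- The equations of lattice-ordered groups, up to a relation `r`. -/
structure Laws {T : Type u} [One T] [Mul T] [Inv T] [Max T] [Min T] (r : T → T → Prop) :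
    Prop where
  mul_assoc : ∀ a b c : T, r (a * b * c) (a * (b * c))
  one_mul : ∀ a : T, r (1 * a) a
  inv_mul : ∀ a : T, r (a⁻¹ * a) 1
  sup_comm : ∀ a b : T, r (a ⊔ b) (b ⊔ a)
  sup_assoc : ∀ a b c : T, r (a ⊔ b ⊔ c) (a ⊔ (b ⊔ c))
  inf_comm : ∀ a b : T, r (a ⊓ b) (b ⊓ a)
  inf_assoc : ∀ a b c : T, r (a ⊓ b ⊓ c) (a ⊓ (b ⊓ c))
  sup_inf_self : ∀ a b : T, r (a ⊔ a ⊓ b) a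
  inf_sup_self : ∀ a b : T, r (a ⊓ (a ⊔ b)) a
  mul_sup : ∀ a b c : T, r (a * (b ⊔ c)) (a * b ⊔ a * c)
  sup_mul : ∀ a b c : T, r ((a ⊔ b) * c) (a * c ⊔ b * c)

lemma laws_eq (X : LGrp.{u}) : Laws (fun a b : X => a = b) where
  mul_assoc := _root_.mul_assoc
  one_mul := _root_.one_mul
  inv_mul := inv_mul_cancel
  sup_comm := _root_.sup_comm
  sup_assoc := _root_.sup_assoc
  inf_comm := _root_.inf_comm
  inf_assoc := _root_.inf_assoc
  sup_inf_self _ _ := _root_.sup_inf_self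
  inf_sup_self _ _ := _root_.inf_sup_self
  mul_sup _ _ _ := _root_.mul_sup _ _ _
  sup_mul _ _ _ := _root_.sup_mul _ _ _

/-- The lattice-ordered group given by operations satisfying the equations. -/
def ofLaws (T : Type u) [One T] [Mul T] [Inv T] [Max T] [Min T]
    (h : Laws (fun a b : T => a = b)) : LGrp.{u} :=
  letI : Group T := Group.ofLeftAxioms h.mul_assoc h.one_mul h.inv_mul
  letI : Lattice T := Lattice.mk' h.sup_comm h.sup_assoc h.inf_comm h.inf_assoc
    h.sup_inf_self h.inf_sup_self
  { carrier := T
    mulLeftMono := ⟨fun a b c hbc => by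
      have e : b ⊔ c = c := sup_eq_right.2 hbc
      refine sup_eq_right.1 ?_
      have := h.mul_sup a b c
      rw [e] at this
      exact this.symm⟩
    mulRightMono := ⟨fun a b c hbc => by
      have e : b ⊔ c = c := sup_eq_right.2 hbc
      refine sup_eq_right.1 ?_
      have := h.sup_mul b c a
      rw [e] at this
      exact this.symm⟩ }

/-! #### Finite limits -/

/-- The trivial lattice-ordered group. -/
def triv : LGrp.{u} :=
  letI : One PUnit.{u + 1} := ⟨⟨⟩⟩
  letI : Mul PUnit.{u + 1} := ⟨fun _ _ => ⟨⟩⟩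
  letI : Inv PUnit.{u + 1} := ⟨fun _ => ⟨⟩⟩
  letI : Max PUnit.{u + 1} := ⟨fun _ _ => ⟨⟩⟩
  letI : Min PUnit.{u + 1} := ⟨fun _ _ => ⟨⟩⟩
  ofLaws PUnit.{u + 1} (by constructor <;> intros <;> rfl)

instance (X : LGrp.{u}) : Unique (X ⟶ triv.{u}) where
  default := 0
  uniq _ := hom_ext fun _ => rfl

instance : HasTerminal LGrp.{u} := hasTerminal_of_unique triv

instance : HasZeroObject LGrp.{u} := hasZeroObject_of_hasTerminal_object

section Pullback

variable {X Y Z : LGrp.{u}} (f : X ⟶ Z) (g : Y ⟶ Z)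

/-- The underlying set of the pullback. -/
def PbType : Type u := {p : X × Y // f p.1 = g p.2}

instance : One (PbType f g) := ⟨⟨(1, 1), by simp⟩⟩
instance : Mul (PbType f g) :=
  ⟨fun a b => ⟨(a.1.1 * b.1.1, a.1.2 * b.1.2), by simp [a.2, b.2]⟩⟩
instance : Inv (PbType f g) := ⟨fun a => ⟨(a.1.1⁻¹, a.1.2⁻¹), by simp [a.2]⟩⟩
instance : Max (PbType f g) :=
  ⟨fun a b => ⟨(a.1.1 ⊔ b.1.1, a.1.2 ⊔ b.1.2), by simp [a.2, b.2]⟩⟩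
instance : Min (PbType f g) :=
  ⟨fun a b => ⟨(a.1.1 ⊓ b.1.1, a.1.2 ⊓ b.1.2), by simp [LGrpHom.map_inf, a.2, b.2]⟩⟩


/-- The pullback of two morphisms, as a subalgebra of the product. -/
def pb : LGrp.{u} :=
  ofLaws (PbType f g) (by
    have hX := laws_eq X
    have hY := laws_eq Y
    constructor <;> intros <;> refine Subtype.ext (Prod.ext ?_ ?_)
    exacts [hX.mul_assoc _ _ _, hY.mul_assoc _ _ _, hX.one_mul _, hY.one_mul _, hX.inv_mul _,
      hY.inv_mul _, hX.sup_comm _ _, hY.sup_comm _ _, hX.sup_assoc _ _ _, hY.sup_assoc _ _ _,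
      hX.inf_comm _ _, hY.inf_comm _ _, hX.inf_assoc _ _ _, hY.inf_assoc _ _ _,
      hX.sup_inf_self _ _, hY.sup_inf_self _ _, hX.inf_sup_self _ _, hY.inf_sup_self _ _,
      hX.mul_sup _ _ _, hY.mul_sup _ _ _, hX.sup_mul _ _ _, hY.sup_mul _ _ _])

/-- The first projection of the pullback. -/
def pbFst : pb f g ⟶ X :=
  mkHom (X := pb f g) (fun p : PbType f g => p.1.1) (fun _ _ => rfl) (fun _ _ => rfl)

/-- The second projection of the pullback. -/
def pbSnd : pb f g ⟶ Y :=
  mkHom (X := pb f g) (fun p : PbType f g => p.1.2) (fun _ _ => rfl) (fun _ _ => rfl)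

lemma pb_condition : pbFst f g ≫ f = pbSnd f g ≫ g :=
  hom_ext fun p : PbType f g => p.2

variable {f g}

/-- An element of the pullback. -/
def pbMk (x : X) (y : Y) (h : f x = g y) : pb f g := (⟨(x, y), h⟩ : PbType f g)

lemma pbFst_mk (x : X) (y : Y) (h : f x = g y) : pbFst f g (pbMk x y h) = x := rfl

lemma pbSnd_mk (x : X) (y : Y) (h : f x = g y) : pbSnd f g (pbMk x y h) = y := rfl

lemma pb_isPullback : IsPullback (pbFst f g) (pbSnd f g) f g :=
  ⟨⟨pb_condition f g⟩, ⟨PullbackCone.IsLimit.mk _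
    (fun s => mkHom (Y := pb f g)
      (fun w => pbMk (s.fst w) (s.snd w) (ConcreteCategory.congr_hom s.condition w))
      (fun a b => Subtype.ext (Prod.ext (map_mul s.fst.toMonoidHom a b)
        (map_mul s.snd.toMonoidHom a b)))
      (fun a b => Subtype.ext (Prod.ext (s.fst.map_sup' a b) (s.snd.map_sup' a b))))
    (fun _ => rfl) (fun _ => rfl)
    (fun _ _ h₁ h₂ => hom_ext fun w => Subtype.ext (Prod.ext
      (ConcreteCategory.congr_hom h₁ w) (ConcreteCategory.congr_hom h₂ w)))⟩⟩

end Pullback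

instance : HasPullbacks LGrp.{u} :=
  have {X Y Z : LGrp.{u}} (f : X ⟶ Z) (g : Y ⟶ Z) : HasLimit (cospan f g) :=
    pb_isPullback.hasPullback
  hasPullbacks_of_hasLimit_cospan _

instance : HasFiniteLimits LGrp.{u} := hasFiniteLimits_of_hasTerminal_and_pullbacks

/-- Monomorphisms are injective. -/
lemma injective_of_mono {X Y : LGrp.{u}} (m : X ⟶ Y) [Mono m] : Function.Injective m := by
  intro a b h
  have e : pbFst m m = pbSnd m m := (cancel_mono m).1 (pb_condition m m)
  exact ConcreteCategory.congr_hom e (pbMk a b h)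

lemma isIso_of_bijective {X Y : LGrp.{u}} (f : X ⟶ Y) (h : Function.Bijective f) : IsIso f := by
  obtain ⟨g, hl, hr⟩ := Function.bijective_iff_has_inverse.1 h
  refine ⟨mkHom g (fun a b => h.1 ?_) (fun a b => h.1 ?_), hom_ext fun x => hl x,
    hom_ext fun x => hr x⟩
  · rw [map_mul, hr, hr, hr]
  · rw [map_sup, hr, hr, hr]

lemma bijective_of_isIso {X Y : LGrp.{u}} (f : X ⟶ Y) [IsIso f] : Function.Bijective f :=
  Function.bijective_iff_has_inverse.2 ⟨inv f,
    fun x => ConcreteCategory.congr_hom (IsIso.hom_inv_id f) x,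
    fun x => ConcreteCategory.congr_hom (IsIso.inv_hom_id f) x⟩

/-! #### Colimits -/

/-- Terms in the operations of lattice-ordered groups with generators `α`. -/
inductive Term (α : Type u) : Type u
  | of : α → Term α
  | one : Term α
  | mul : Term α → Term α → Term α
  | inv : Term α → Term α
  | sup : Term α → Term α → Term α
  | inf : Term α → Term α → Term α

namespace Term

variable {α : Type u}

instance : One (Term α) := ⟨one⟩
instance : Mul (Term α) := ⟨mul⟩
instance : Inv (Term α) := ⟨inv⟩
instance : Max (Term α) := ⟨sup⟩
instance : Min (Term α) := ⟨inf⟩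

/-- Evaluation of terms. -/
def eval {X : LGrp.{u}} (v : α → X) : Term α → X
  | of a => v a
  | one => 1
  | mul s t => eval v s * eval v t
  | inv t => (eval v t)⁻¹
  | sup s t => eval v s ⊔ eval v t
  | inf s t => eval v s ⊓ eval v t

end Term

/-- A relation on `T` compatible with the operations, modulo which the equations of
lattice-ordered groups hold. -/
structure Congr (T : Type u) [One T] [Mul T] [Inv T] [Max T] [Min T] extends Setoid T where
  mul : ∀ {a b c d}, r a b → r c d → r (a * c) (b * d)
  inv : ∀ {a b}, r a b → r a⁻¹ b⁻¹
  sup : ∀ {a b c d}, r a b → r c d → r (a ⊔ c) (b ⊔ d)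
  inf : ∀ {a b c d}, r a b → r c d → r (a ⊓ c) (b ⊓ d)
  laws : Laws r

namespace Congr

variable {T : Type u} [One T] [Mul T] [Inv T] [Max T] [Min T] (c : Congr T)

/-- The underlying set of the quotient by a congruence. -/
def Quot : Type u := Quotient c.toSetoid

/-- The class of an element. -/
def cls (t : T) : c.Quot := Quotient.mk c.toSetoid t

instance : One c.Quot := ⟨c.cls 1⟩
instance : Mul c.Quot := ⟨Quotient.map₂ (· * ·) fun _ _ h _ _ h' => c.mul h h'⟩
instance : Inv c.Quot := ⟨Quotient.map (·⁻¹) fun _ _ h => c.inv h⟩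
instance : Max c.Quot := ⟨Quotient.map₂ (· ⊔ ·) fun _ _ h _ _ h' => c.sup h h'⟩
instance : Min c.Quot := ⟨Quotient.map₂ (· ⊓ ·) fun _ _ h _ _ h' => c.inf h h'⟩

/-- The quotient by a congruence. -/
def quot : LGrp.{u} :=
  ofLaws c.Quot
    { mul_assoc := by rintro ⟨a⟩ ⟨b⟩ ⟨d⟩; exact Quotient.sound (c.laws.mul_assoc a b d)
      one_mul := by rintro ⟨a⟩; exact Quotient.sound (c.laws.one_mul a)
      inv_mul := by rintro ⟨a⟩; exact Quotient.sound (c.laws.inv_mul a)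
      sup_comm := by rintro ⟨a⟩ ⟨b⟩; exact Quotient.sound (c.laws.sup_comm a b)
      sup_assoc := by rintro ⟨a⟩ ⟨b⟩ ⟨d⟩; exact Quotient.sound (c.laws.sup_assoc a b d)
      inf_comm := by rintro ⟨a⟩ ⟨b⟩; exact Quotient.sound (c.laws.inf_comm a b)
      inf_assoc := by rintro ⟨a⟩ ⟨b⟩ ⟨d⟩; exact Quotient.sound (c.laws.inf_assoc a b d)
      sup_inf_self := by rintro ⟨a⟩ ⟨b⟩; exact Quotient.sound (c.laws.sup_inf_self a b)
      inf_sup_self := by rintro ⟨a⟩ ⟨b⟩; exact Quotient.sound (c.laws.inf_sup_self a b)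
      mul_sup := by rintro ⟨a⟩ ⟨b⟩ ⟨d⟩; exact Quotient.sound (c.laws.mul_sup a b d)
      sup_mul := by rintro ⟨a⟩ ⟨b⟩ ⟨d⟩; exact Quotient.sound (c.laws.sup_mul a b d) }

end Congr

section Colimit

variable {J : Type u} [SmallCategory J] (F : J ⥤ LGrp.{u})

/-- The valuation of the elements of a diagram in the vertex of a cocone. -/
def coconeVal (s : Cocone F) (p : Σ j, F.obj j) : s.pt := s.ι.app p.1 p.2

/-- Two terms in the elements of a diagram are identified if they agree in every cocone. -/
def colimitCongr : Congr (Term (Σ j, F.obj j)) where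
  r t t' := ∀ s : Cocone F, t.eval (coconeVal F s) = t'.eval (coconeVal F s)
  iseqv := ⟨fun _ _ => rfl, fun h s => (h s).symm, fun h h' s => (h s).trans (h' s)⟩
  mul h h' s := congrArg₂ (· * ·) (h s) (h' s)
  inv h s := congrArg (·⁻¹) (h s)
  sup h h' s := congrArg₂ (· ⊔ ·) (h s) (h' s)
  inf h h' s := congrArg₂ (· ⊓ ·) (h s) (h' s)
  laws :=
    { mul_assoc := fun _ _ _ s => (laws_eq s.pt).mul_assoc _ _ _
      one_mul := fun _ s => (laws_eq s.pt).one_mul _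
      inv_mul := fun _ s => (laws_eq s.pt).inv_mul _
      sup_comm := fun _ _ s => (laws_eq s.pt).sup_comm _ _
      sup_assoc := fun _ _ _ s => (laws_eq s.pt).sup_assoc _ _ _
      inf_comm := fun _ _ s => (laws_eq s.pt).inf_comm _ _
      inf_assoc := fun _ _ _ s => (laws_eq s.pt).inf_assoc _ _ _
      sup_inf_self := fun _ _ s => (laws_eq s.pt).sup_inf_self _ _
      inf_sup_self := fun _ _ s => (laws_eq s.pt).inf_sup_self _ _
      mul_sup := fun _ _ _ s => (laws_eq s.pt).mul_sup _ _ _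
      sup_mul := fun _ _ _ s => (laws_eq s.pt).sup_mul _ _ _ }

/-- The colimit cocone of a diagram. -/
def colimitCocone : Cocone F where
  pt := (colimitCongr F).quot
  ι :=
    { app := fun j => mkHom (Y := (colimitCongr F).quot)
        (fun x => (colimitCongr F).cls (Term.of ⟨j, x⟩))
        (fun a b => Quotient.sound fun s => map_mul (s.ι.app j).toMonoidHom a b)
        (fun a b => Quotient.sound fun s => (s.ι.app j).map_sup' a b)
      naturality := fun _ _ f => hom_ext fun x => Quotient.sound fun s =>
        ConcreteCategory.congr_hom (s.w f) x }

/-- The morphism from the colimit to the vertex of a cocone. -/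
def colimitDesc (s : Cocone F) : (colimitCocone F).pt ⟶ s.pt :=
  mkHom (X := (colimitCongr F).quot)
    (Quotient.lift (fun t => t.eval (coconeVal F s)) fun _ _ h => h s)
    (by rintro ⟨a⟩ ⟨b⟩; rfl) (by rintro ⟨a⟩ ⟨b⟩; rfl)

/-- The colimit cocone has the universal property. -/
def colimitIsColimit : IsColimit (colimitCocone F) where
  desc := colimitDesc F
  fac _ _ := rfl
  uniq s m h := hom_ext fun x => by
    obtain ⟨t⟩ := x
    change m ((colimitCongr F).cls t) = t.eval (coconeVal F s)
    induction t with
    | of p => exact ConcreteCategory.congr_hom (h p.1) p.2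
    | one => exact map_one m.toMonoidHom
    | mul a b ha hb => exact (map_mul m.toMonoidHom _ _).trans (congrArg₂ (· * ·) ha hb)
    | inv a ha => exact (map_inv m.toMonoidHom _).trans (congrArg (·⁻¹) ha)
    | sup a b ha hb => exact (m.map_sup' _ _).trans (congrArg₂ (· ⊔ ·) ha hb)
    | inf a b ha hb => exact (LGrpHom.map_inf m _ _).trans (congrArg₂ (· ⊓ ·) ha hb)

end Colimit

instance : HasColimits LGrp.{u} :=
  ⟨fun _ _ => ⟨fun F => ⟨⟨⟨colimitCocone F, colimitIsColimit F⟩⟩⟩⟩⟩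

instance : HasFiniteColimits LGrp.{u} := hasFiniteColimits_of_hasColimits _

/-! #### Lattice-ordered groups form a semi-abelian category -/

section Range

variable {X Y : LGrp.{u}} (f : X ⟶ Y)

/-- The set-theoretic image of a morphism. -/
def RangeType : Type u := {y : Y // ∃ x, f x = y}

instance : One (RangeType f) := ⟨⟨1, 1, map_one f.toMonoidHom⟩⟩
instance : Mul (RangeType f) := ⟨fun a b => ⟨a.1 * b.1, by
  obtain ⟨_, x, rfl⟩ := a
  obtain ⟨_, y, rfl⟩ := b
  exact ⟨x * y, map_mul f.toMonoidHom x y⟩⟩⟩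
instance : Inv (RangeType f) := ⟨fun a => ⟨a.1⁻¹, by
  obtain ⟨_, x, rfl⟩ := a
  exact ⟨x⁻¹, map_inv f.toMonoidHom x⟩⟩⟩
instance : Max (RangeType f) := ⟨fun a b => ⟨a.1 ⊔ b.1, by
  obtain ⟨_, x, rfl⟩ := a
  obtain ⟨_, y, rfl⟩ := b
  exact ⟨x ⊔ y, f.map_sup' x y⟩⟩⟩
instance : Min (RangeType f) := ⟨fun a b => ⟨a.1 ⊓ b.1, by
  obtain ⟨_, x, rfl⟩ := a
  obtain ⟨_, y, rfl⟩ := b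
  exact ⟨x ⊓ y, LGrpHom.map_inf f x y⟩⟩⟩

/-- The set-theoretic image of a morphism, as a subalgebra. -/
def range : LGrp.{u} :=
  ofLaws (RangeType f) (by
    have hY := laws_eq Y
    constructor <;> intros <;> refine Subtype.ext ?_
    exacts [hY.mul_assoc _ _ _, hY.one_mul _, hY.inv_mul _, hY.sup_comm _ _, hY.sup_assoc _ _ _,
      hY.inf_comm _ _, hY.inf_assoc _ _ _, hY.sup_inf_self _ _, hY.inf_sup_self _ _,
      hY.mul_sup _ _ _, hY.sup_mul _ _ _])

/-- The inclusion of the set-theoretic image. -/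
def rangeι : range f ⟶ Y :=
  mkHom (X := range f) (fun p : RangeType f => p.1) (fun _ _ => rfl) (fun _ _ => rfl)

/-- The corestriction of a morphism to its set-theoretic image. -/
def toRange : X ⟶ range f :=
  mkHom (Y := range f) (fun x => (⟨f x, x, rfl⟩ : RangeType f))
    (fun a b => Subtype.ext (map_mul f.toMonoidHom a b)) (fun a b => Subtype.ext (f.map_sup' a b))

lemma toRange_comp : toRange f ≫ rangeι f = f := rfl

instance : Mono (rangeι f) :=
  ⟨fun _ _ h => hom_ext fun x => Subtype.ext (ConcreteCategory.congr_hom h x)⟩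

end Range

/-- Regular epimorphisms are exactly the surjective morphisms. -/
lemma isRegularEpi_iff {X Y : LGrp.{u}} (f : X ⟶ Y) :
    IsRegularEpi f ↔ Function.Surjective f := by
  constructor
  · rintro ⟨⟨h⟩⟩
    have w : h.left ≫ toRange f = h.right ≫ toRange f := by
      rw [← cancel_mono (rangeι f), Category.assoc, Category.assoc, toRange_comp, h.w]
    obtain ⟨d, hd⟩ := Cofork.IsColimit.desc' h.isColimit (toRange f) w
    have := h.epi
    have e : d ≫ rangeι f = 𝟙 Y := by
      have hd' : f ≫ d = toRange f := hd
      rw [← cancel_epi f, ← Category.assoc, hd', toRange_comp, Category.comp_id]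
    intro y
    obtain ⟨x, hx⟩ := (show RangeType f from d y).2
    exact ⟨x, hx.trans (ConcreteCategory.congr_hom e y)⟩
  · intro hf
    choose g hg using hf
    have key {Z : LGrp.{u}} (k : X ⟶ Z) (hk : pbFst f f ≫ k = pbSnd f f ≫ k) {a b : X}
        (hab : f a = f b) : k a = k b :=
      ConcreteCategory.congr_hom hk (pbMk a b hab)
    refine ⟨⟨⟨_, pbFst f f, pbSnd f f, pb_condition f f, Cofork.IsColimit.mk _
      (fun s => mkHom (fun y => s.π (g y)) (fun a b => ?_) (fun a b => ?_))
      (fun s => hom_ext fun x => ?_) (fun s m hm => hom_ext fun y => ?_)⟩⟩⟩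
    · rw [← map_mul]
      exact key _ s.condition (by simp [hg])
    · rw [← map_sup]
      exact key _ s.condition (by simp [hg])
    · exact key _ s.condition (hg _)
    · have := ConcreteCategory.congr_hom hm (g y)
      refine Eq.trans ?_ this
      exact congrArg m (hg y).symm

instance : Regular LGrp.{u} where
  hasCoequalizer_of_isKernelPair _ := inferInstance
  regularEpiIsStableUnderBaseChange := ⟨by
    intro _ _ _ _ f g f' g' h hg
    rw [MorphismProperty.regularEpi_iff, isRegularEpi_iff] at hg ⊢
    intro y
    obtain ⟨x, hx⟩ := hg (f y)
    let l := h.lift (pbFst g f) (pbSnd g f) (pb_condition g f)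
    exact ⟨l (pbMk x y hx), ConcreteCategory.congr_hom (h.lift_snd _ _ _) (pbMk x y hx)⟩⟩

/-- The congruence on `X` given by an internal equivalence relation. -/
def congrOfRel {R X : LGrp.{u}} (p₁ p₂ : R ⟶ X) (e : X ⟶ R) (h₁ : ∀ x, p₁ (e x) = x)
    (h₂ : ∀ x, p₂ (e x) = x) : Congr X where
  r x y := ∃ t, p₁ t = x ∧ p₂ t = y
  iseqv := by
    refine ⟨fun x => ⟨e x, h₁ x, h₂ x⟩, ?_, ?_⟩
    · rintro _ _ ⟨t, rfl, rfl⟩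
      exact ⟨e (p₁ t) * t⁻¹ * e (p₂ t), by simp [h₁], by simp [h₂]⟩
    · rintro _ _ _ ⟨t, rfl, rfl⟩ ⟨t', h, rfl⟩
      exact ⟨t * (e (p₂ t))⁻¹ * t', by simp [h₁, h], by simp [h₂]⟩
  mul := by
    rintro _ _ _ _ ⟨t, rfl, rfl⟩ ⟨t', rfl, rfl⟩
    exact ⟨t * t', by simp, by simp⟩
  inv := by
    rintro _ _ ⟨t, rfl, rfl⟩
    exact ⟨t⁻¹, by simp, by simp⟩
  sup := by
    rintro _ _ _ _ ⟨t, rfl, rfl⟩ ⟨t', rfl, rfl⟩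
    exact ⟨t ⊔ t', by simp, by simp⟩
  inf := by
    rintro _ _ _ _ ⟨t, rfl, rfl⟩ ⟨t', rfl, rfl⟩
    exact ⟨t ⊓ t', LGrpHom.map_inf _ _ _, LGrpHom.map_inf _ _ _⟩
  laws := by
    have hX := laws_eq X
    have hr : ∀ {x y : X}, x = y → ∃ t, p₁ t = x ∧ p₂ t = y := by
      rintro x _ rfl
      exact ⟨e x, h₁ x, h₂ x⟩
    constructor <;> intros <;> apply hr
    exacts [hX.mul_assoc _ _ _, hX.one_mul _, hX.inv_mul _, hX.sup_comm _ _, hX.sup_assoc _ _ _,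
      hX.inf_comm _ _, hX.inf_assoc _ _ _, hX.sup_inf_self _ _, hX.inf_sup_self _ _,
      hX.mul_sup _ _ _, hX.sup_mul _ _ _]

lemma exists_isKernelPair {R X : LGrp.{u}} (p₁ p₂ : R ⟶ X) (h : IsEquivalenceRelation p₁ p₂) :
    ∃ (Y : LGrp.{u}) (f : X ⟶ Y), IsKernelPair f p₁ p₂ := by
  obtain ⟨⟨h⟩⟩ := h
  let c := congrOfRel p₁ p₂ h.r (ConcreteCategory.congr_hom h.reflexivity₁)
    (ConcreteCategory.congr_hom h.reflexivity₂)
  let f : X ⟶ c.quot := mkHom (Y := c.quot) c.cls (fun _ _ => rfl) (fun _ _ => rfl)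
  have w : p₁ ≫ f = p₂ ≫ f := hom_ext fun t => Quotient.sound ⟨t, rfl, rfl⟩
  let m : R ⟶ pb f f := pb_isPullback.lift p₁ p₂ w
  have m₁ : m ≫ pbFst f f = p₁ := pb_isPullback.lift_fst _ _ _
  have m₂ : m ≫ pbSnd f f = p₂ := pb_isPullback.lift_snd _ _ _
  have : Mono m := ⟨fun a b hab => h.right_cancellation a b
    (by rw [← m₁, ← Category.assoc, hab, Category.assoc])
    (by rw [← m₂, ← Category.assoc, hab, Category.assoc])⟩
  have : IsIso m := isIso_of_bijective m ⟨injective_of_mono m, by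
    intro q
    obtain ⟨t, h₁, h₂⟩ := Quotient.exact (show PbType f f from q).2
    refine ⟨t, Subtype.ext (Prod.ext ?_ ?_)⟩
    · exact (ConcreteCategory.congr_hom m₁ t).trans h₁
    · exact (ConcreteCategory.congr_hom m₂ t).trans h₂⟩
  exact ⟨_, f, IsPullback.of_iso pb_isPullback (asIso m).symm (Iso.refl _) (Iso.refl _)
    (Iso.refl _) (by simp [m₁]) (by simp [m₂]) (by simp) (by simp)⟩

lemma exists_kernel_ι {X Y : LGrp.{u}} (f : X ⟶ Y) (x : X) (hx : f x = 1) :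
    ∃ k : (kernel f : LGrp.{u}), kernel.ι f k = x := by
  let l : pb f (0 : X ⟶ Y) ⟶ kernel f := kernel.lift f (pbFst f 0) (by
    rw [pb_condition, comp_zero])
  exact ⟨l (pbMk x 1 hx), ConcreteCategory.congr_hom (kernel.lift_ι f _ _) (pbMk x 1 hx)⟩

instance : SemiAbelian LGrp.{u} where
  hasZeroObject := inferInstance
  hasFiniteCoproducts := inferInstance
  isKernelPair_of_isEquivalenceRelation := exists_isKernelPair
  splitShortFive := by
    intro A B A' B' p s p' s' u v hs hs' hp hsu hk hv
    have hk := bijective_of_isIso (kernel.map p p' u v hp)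
    have hv := bijective_of_isIso v
    have ek : ∀ k, kernel.ι p' (kernel.map p p' u v hp k) = u (kernel.ι p k) :=
      ConcreteCategory.congr_hom (kernel.lift_ι p' _ _)
    have ep : ∀ a, v (p a) = p' (u a) := ConcreteCategory.congr_hom hp
    have es : ∀ b, u (s b) = s' (v b) := ConcreteCategory.congr_hom hsu
    have es' : ∀ b, p' (s' b) = b := ConcreteCategory.congr_hom hs'
    have e0 : ∀ k, p (kernel.ι p k) = 1 := ConcreteCategory.congr_hom (kernel.condition p)
    refine isIso_of_bijective u ⟨?_, fun a' => ?_⟩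
    · refine (injective_iff_map_eq_one u.toMonoidHom).2 fun a (ha : u a = 1) => ?_
      have hpa : p a = 1 := hv.1 (by rw [ep, ha, map_one, map_one])
      obtain ⟨k, rfl⟩ := exists_kernel_ι p a hpa
      have : k = 1 := hk.1 (injective_of_mono (kernel.ι p') (by rw [ek, ha, map_one, map_one]))
      rw [this, map_one]
    · obtain ⟨b, hb⟩ := hv.2 (p' a')
      obtain ⟨k', hk'⟩ := exists_kernel_ι p' (a' * (s' (p' a'))⁻¹) (by simp [es'])
      obtain ⟨k, rfl⟩ := hk.2 k'
      rw [ek] at hk'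
      exact ⟨kernel.ι p k * s b, by rw [map_mul, hk', es, hb, inv_mul_cancel_right]⟩

end LGrp

/-!
Both commutators of two ideals `H`, `K` of a lattice-ordered group `X` turn out to be `H ⊓ K`,
which is an ideal, being the kernel of `X ⟶ Z × Z'` when `H` and `K` are the kernels of
`f : X ⟶ Z` and `g : X ⟶ Z'`.

* In a product `A × B` the elements `(a, 1)` and `(1, b)` with `1 ≤ a` and `1 ≤ b` have meet `1`
  (`prodInl_inf_prodInr`). Hence, if `A` and `B` cooperate in `Y`, then an element `1 ≤ y` of
  `A ⊓ B` is the image of `(y, 1) ⊓ (1, y) = 1`, so `y = 1`; applying this to `y ⊔ 1` and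
  `y⁻¹ ⊔ 1` shows that `A ⊓ B` is trivial (`eq_one_of_cooperate`). Likewise an element `1 ≤ x` of
  `H ⊓ K` is the image of `ι₁ x ⊓ ι₂ x`, which lies in the kernel of `Σ : H + K ⟶ H × K`; so
  `H ⊓ K` is contained in the Higgins commutator (`mem_higginsCommutator`).
* Conversely, the quotient `X / (H ⊓ K)` embeds in `Z × Z'`, where `H` goes to elements `(1, z')`
  and `K` to elements `(z, 1)`. All identities needed for multiplication to define a morphism from
  the product of the images of `H` and `K` are then checked in each factor
  (`cooperateModulo_inf`).
  And `H + K ⟶ X ⟶ Z` factors through `Σ`, because it vanishes on `H`; so the Higgins commutator is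
  contained in `H`, and by the same argument in `K` (`higginsCommutator_eq_inf`).
-/

namespace LGrp

/-! ### Elements of subobjects -/

/-- `x` is an element of the subobject `A`: it lies in the image of the inclusion of `A`. -/
def Mem {X : LGrp.{u}} (A : Subobject X) (x : X) : Prop := ∃ a : (A : LGrp.{u}), A.arrow a = x

section Elements

variable {X Y : LGrp.{u}}

lemma Mem.mul {A : Subobject X} {x y : X} (hx : Mem A x) (hy : Mem A y) : Mem A (x * y) := by
  obtain ⟨a, rfl⟩ := hx
  obtain ⟨b, rfl⟩ := hy
  exact ⟨a * b, map_mul _ _ _⟩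

lemma Mem.inv {A : Subobject X} {x : X} (hx : Mem A x) : Mem A x⁻¹ := by
  obtain ⟨a, rfl⟩ := hx
  exact ⟨a⁻¹, map_inv _ _⟩

lemma factors_iff (A : Subobject X) (f : Y ⟶ X) : A.Factors f ↔ ∀ y, Mem A (f y) := by
  constructor
  · intro h y
    exact ⟨A.factorThru f h y, ConcreteCategory.congr_hom (A.factorThru_arrow f h) y⟩
  · intro h
    choose g hg using h
    have inj := injective_of_mono A.arrow
    have hm (a b : Y) : g (a * b) = g a * g b := inj (by rw [map_mul, hg, hg, hg, map_mul])
    have hs (a b : Y) : g (a ⊔ b) = g a ⊔ g b := inj (by rw [map_sup, hg, hg, hg, map_sup])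
    have e : mkHom g hm hs ≫ A.arrow = f := hom_ext hg
    rw [← e]
    exact Subobject.factors_comp_arrow _

lemma le_iff (A B : Subobject X) : A ≤ B ↔ ∀ x, Mem A x → Mem B x := by
  constructor
  · rintro h _ ⟨a, rfl⟩
    exact ⟨Subobject.ofLE A B h a, ConcreteCategory.congr_hom (Subobject.ofLE_arrow h) a⟩
  · intro h
    have hf : B.Factors A.arrow := (factors_iff B A.arrow).2 fun a => h _ ⟨a, rfl⟩
    exact Subobject.le_of_comm (B.factorThru _ hf) (B.factorThru_arrow _ hf)

lemma mem_inf (A B : Subobject X) (x : X) : Mem (A ⊓ B) x ↔ Mem A x ∧ Mem B x := by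
  constructor
  · exact fun h => ⟨(le_iff _ _).1 inf_le_left x h, (le_iff _ _).1 inf_le_right x h⟩
  · rintro ⟨⟨a, rfl⟩, b, hb⟩
    have h₁ : A.Factors (pbFst A.arrow B.arrow ≫ A.arrow) := Subobject.factors_comp_arrow _
    have h₂ : B.Factors (pbFst A.arrow B.arrow ≫ A.arrow) := by
      rw [pb_condition]
      exact Subobject.factors_comp_arrow _
    exact (factors_iff _ _).1 ((Subobject.inf_factors _).2 ⟨h₁, h₂⟩) (pbMk a b hb.symm)

lemma mem_imageSubobject (f : Y ⟶ X) (x : X) : Mem (imageSubobject f) x ↔ ∃ y, f y = x := by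
  constructor
  · rintro ⟨a, rfl⟩
    have h := imageSubobject_le_mk (rangeι f) f (toRange f) (toRange_comp f)
    obtain ⟨y, hy⟩ := (show RangeType f from Subobject.ofLEMk _ _ h a).2
    exact ⟨y, hy.trans (ConcreteCategory.congr_hom (Subobject.ofLEMk_comp h) a)⟩
  · rintro ⟨y, rfl⟩
    exact ⟨factorThruImageSubobject f y,
      ConcreteCategory.congr_hom (imageSubobject_arrow_comp f) y⟩

/-- If the elements of `A` are those sent to `1` by `f`, then `A` has the universal property of the
kernel of `f`. -/
lemma isIdeal_of_mem_iff {A : Subobject X} (f : X ⟶ Y) (h : ∀ x, Mem A x ↔ f x = 1) :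
    IsIdeal A := by
  have lift {W : LGrp.{u}} (k : W ⟶ X) (hk : k ≫ f = 0) : A.Factors k :=
    (factors_iff A k).2 fun w => (h _).2 (ConcreteCategory.congr_hom hk w)
  exact ⟨⟨Y, f, hom_ext fun a => (h _).1 ⟨a, rfl⟩,
    KernelFork.IsLimit.ofι _ _ (fun k hk => A.factorThru k (lift k hk))
      (fun k hk => A.factorThru_arrow k (lift k hk))
      (fun k hk m hm => (cancel_mono A.arrow).1 (hm.trans (A.factorThru_arrow k _).symm))⟩⟩

lemma exists_mem_iff_of_isIdeal {A : Subobject X} (h : IsIdeal A) :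
    ∃ (Z : LGrp.{u}) (f : X ⟶ Z), ∀ x, Mem A x ↔ f x = 1 := by
  obtain ⟨Z, f, w, hl⟩ := h
  refine ⟨Z, f, fun x => ⟨?_, fun hx => ?_⟩⟩
  · rintro ⟨a, rfl⟩
    exact ConcreteCategory.congr_hom w a
  · obtain ⟨k, rfl⟩ := exists_kernel_ι f x hx
    obtain ⟨l, hl⟩ := KernelFork.IsLimit.lift' hl (kernel.ι f) (kernel.condition f)
    exact ⟨l k, ConcreteCategory.congr_hom hl k⟩

/-! ### Elements of products -/

section Products

variable (A B : LGrp.{u})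

/-- The inclusion `(id, 0)` of the first factor of a product. -/
noncomputable abbrev prodInl : A ⟶ A ⨯ B := prod.lift (𝟙 A) 0

/-- The inclusion `(0, id)` of the second factor of a product. -/
noncomputable abbrev prodInr : B ⟶ A ⨯ B := prod.lift 0 (𝟙 B)

variable {A B}

lemma fst_prodInl (a : A) : (prod.fst : A ⨯ B ⟶ A) (prodInl A B a) = a :=
  ConcreteCategory.congr_hom (prod.lift_fst _ _) a

lemma snd_prodInl (a : A) : (prod.snd : A ⨯ B ⟶ B) (prodInl A B a) = 1 :=
  ConcreteCategory.congr_hom (prod.lift_snd _ _) a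

lemma fst_prodInr (b : B) : (prod.fst : A ⨯ B ⟶ A) (prodInr A B b) = 1 :=
  ConcreteCategory.congr_hom (prod.lift_fst _ _) b

lemma snd_prodInr (b : B) : (prod.snd : A ⨯ B ⟶ B) (prodInr A B b) = b :=
  ConcreteCategory.congr_hom (prod.lift_snd _ _) b

lemma prod_eq_one {t : (A ⨯ B : LGrp.{u})} (h₁ : (prod.fst : A ⨯ B ⟶ A) t = 1)
    (h₂ : (prod.snd : A ⨯ B ⟶ B) t = 1) : t = 1 := by
  -- `t` is the image of an element under a morphism whose composites with both projections are `0`.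
  obtain ⟨k, rfl⟩ := exists_kernel_ι (prod.fst : A ⨯ B ⟶ A) t h₁
  obtain ⟨l, rfl⟩ := exists_kernel_ι (kernel.ι (prod.fst : A ⨯ B ⟶ A) ≫ prod.snd) k h₂
  have z : kernel.ι (kernel.ι (prod.fst : A ⨯ B ⟶ A) ≫ prod.snd) ≫
      kernel.ι (prod.fst : A ⨯ B ⟶ A) = 0 := by
    refine Limits.prod.hom_ext ?_ ?_
    · rw [Category.assoc, kernel.condition, comp_zero, zero_comp]
    · rw [Category.assoc, kernel.condition, zero_comp]
  exact ConcreteCategory.congr_hom z l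

/-- In a product, positive elements of the two factors are disjoint. -/
lemma prodInl_inf_prodInr {a : A} {b : B} (ha : 1 ≤ a) (hb : 1 ≤ b) :
    prodInl A B a ⊓ prodInr A B b = 1 := by
  refine prod_eq_one ?_ ?_
  · rw [LGrpHom.map_inf, fst_prodInl, fst_prodInr, inf_eq_right.2 ha]
  · rw [LGrpHom.map_inf, snd_prodInl, snd_prodInr, inf_eq_left.2 hb]

end Products

/-! ### The intersection of two ideals -/

lemma isIdeal_inf {H K : Subobject X} (hH : IsIdeal H) (hK : IsIdeal K) : IsIdeal (H ⊓ K) := by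
  obtain ⟨Z, f, hf⟩ := exists_mem_iff_of_isIdeal hH
  obtain ⟨Z', g, hg⟩ := exists_mem_iff_of_isIdeal hK
  refine isIdeal_of_mem_iff (prod.lift f g) fun x => ?_
  have h₁ : (prod.fst : Z ⨯ Z' ⟶ Z) (prod.lift f g x) = f x :=
    ConcreteCategory.congr_hom (prod.lift_fst f g) x
  have h₂ : (prod.snd : Z ⨯ Z' ⟶ Z') (prod.lift f g x) = g x :=
    ConcreteCategory.congr_hom (prod.lift_snd f g) x
  rw [mem_inf, hf, hg, ← h₁, ← h₂]
  exact ⟨fun h => prod_eq_one h.1 h.2, fun h => by simp [h]⟩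

/-! ### Cokernels -/

/-- An ideal is the kernel of its cokernel. -/
lemma cokernel_π_eq_one_iff {M : Subobject X} (hM : IsIdeal M) (x : X) :
    cokernel.π M.arrow x = 1 ↔ Mem M x := by
  constructor
  · intro hx
    obtain ⟨Z, f, hf⟩ := exists_mem_iff_of_isIdeal hM
    have w : M.arrow ≫ f = 0 := hom_ext fun a => (hf _).1 ⟨a, rfl⟩
    have e : cokernel.desc M.arrow f w (cokernel.π M.arrow x) = f x :=
      ConcreteCategory.congr_hom (cokernel.π_desc M.arrow f w) x
    rw [hf, ← e, hx, map_one]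
  · rintro ⟨a, rfl⟩
    exact ConcreteCategory.congr_hom (cokernel.condition M.arrow) a

lemma cokernel_π_eq_iff {M : Subobject X} (hM : IsIdeal M) (x y : X) :
    cokernel.π M.arrow x = cokernel.π M.arrow y ↔ Mem M (x * y⁻¹) := by
  rw [← cokernel_π_eq_one_iff hM, map_mul, map_inv, mul_inv_eq_one]

/-! ### The Huq commutator -/

/-- The quotient by `H ⊓ K` embeds in `X / H × X / K`, so an equation between products of elements
of `H` and of `K` may be checked after killing `H` and after killing `K`. -/
lemma cooperateModulo_inf {H K : Subobject X} (hH : IsIdeal H) (hK : IsIdeal K) :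
    CooperateModulo H K (H ⊓ K) := by
  obtain ⟨Z, f, hf⟩ := exists_mem_iff_of_isIdeal hH
  obtain ⟨Z', g, hg⟩ := exists_mem_iff_of_isIdeal hK
  let q := cokernel.π (H ⊓ K).arrow
  have hq {x y : X} (h₁ : f x = f y) (h₂ : g x = g y) : q x = q y := by
    rw [cokernel_π_eq_iff (isIdeal_inf hH hK), mem_inf, hf, hg]
    simp [h₁, h₂]
  let A := imageSubobject (H.arrow ≫ q)
  let B := imageSubobject (K.arrow ≫ q)
  have hA (a : (A : LGrp.{u})) : ∃ x, f x = 1 ∧ q x = A.arrow a := by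
    obtain ⟨h, e⟩ := (mem_imageSubobject (H.arrow ≫ q) _).1 ⟨a, rfl⟩
    exact ⟨H.arrow h, (hf _).1 ⟨h, rfl⟩, e⟩
  have hB (b : (B : LGrp.{u})) : ∃ x, g x = 1 ∧ q x = B.arrow b := by
    obtain ⟨k, e⟩ := (mem_imageSubobject (K.arrow ≫ q) _).1 ⟨b, rfl⟩
    exact ⟨K.arrow k, (hg _).1 ⟨k, rfl⟩, e⟩
  let p₁ : (A : LGrp.{u}) ⨯ (B : LGrp.{u}) ⟶ (A : LGrp.{u}) := prod.fst
  let p₂ : (A : LGrp.{u}) ⨯ (B : LGrp.{u}) ⟶ (B : LGrp.{u}) := prod.snd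
  refine ⟨mkHom (fun t => A.arrow (p₁ t) * B.arrow (p₂ t)) (fun s t => ?_) (fun s t => ?_),
    hom_ext fun a => ?_, hom_ext fun b => ?_⟩
  · obtain ⟨x, hx, ex⟩ := hA (p₁ s)
    obtain ⟨y, hy, ey⟩ := hB (p₂ s)
    obtain ⟨x', hx', ex'⟩ := hA (p₁ t)
    obtain ⟨y', hy', ey'⟩ := hB (p₂ t)
    simp only [map_mul, ← ex, ← ey, ← ex', ← ey']
    simp only [← map_mul]
    exact hq (by simp [hx, hx']) (by simp [hy, hy'])
  · obtain ⟨x, hx, ex⟩ := hA (p₁ s)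
    obtain ⟨y, hy, ey⟩ := hB (p₂ s)
    obtain ⟨x', hx', ex'⟩ := hA (p₁ t)
    obtain ⟨y', hy', ey'⟩ := hB (p₂ t)
    simp only [map_sup, ← ex, ← ey, ← ex', ← ey']
    simp only [← map_mul, ← map_sup]
    exact hq (by simp [hx, hx']) (by simp [hy, hy'])
  · change A.arrow (p₁ (prodInl A B a)) * B.arrow (p₂ (prodInl A B a)) = A.arrow a
    rw [fst_prodInl, snd_prodInl, map_one, mul_one]
  · change A.arrow (p₁ (prodInr A B b)) * B.arrow (p₂ (prodInr A B b)) = B.arrow b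
    rw [fst_prodInr, snd_prodInr, map_one, one_mul]

lemma Mem.exists_one_le {A : Subobject X} {x : X} (hx : Mem A x) :
    ∃ a : (A : LGrp.{u}), 1 ≤ a ∧ A.arrow a = x ⊔ 1 := by
  obtain ⟨a, rfl⟩ := hx
  exact ⟨a ⊔ 1, le_sup_right, by rw [map_sup, map_one]⟩

/-- Cooperating subobjects have trivial intersection. -/
lemma eq_one_of_cooperate {A B : Subobject X} (h : Cooperate A B) {x : X} (hA : Mem A x)
    (hB : Mem B x) : x = 1 := by
  obtain ⟨φ, h₁, h₂⟩ := h
  have key {y : X} (hA : Mem A y) (hB : Mem B y) : y ≤ 1 := by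
    obtain ⟨a, ha, ea⟩ := hA.exists_one_le
    obtain ⟨b, hb, eb⟩ := hB.exists_one_le
    have e₁ : φ (prodInl _ _ a) = y ⊔ 1 := (ConcreteCategory.congr_hom h₁ a).trans ea
    have e₂ : φ (prodInr _ _ b) = y ⊔ 1 := (ConcreteCategory.congr_hom h₂ b).trans eb
    rw [← sup_eq_right, ← inf_idem (y ⊔ 1)]
    nth_rewrite 1 [← e₁]
    rw [← e₂, ← LGrpHom.map_inf, prodInl_inf_prodInr ha hb, map_one]
  exact le_antisymm (key hA hB) (inv_le_one'.1 (key hA.inv hB.inv))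

lemma isHuqCommutator_inf {H K : Subobject X} (hH : IsIdeal H) (hK : IsIdeal K) :
    IsHuqCommutator H K (H ⊓ K) := by
  refine ⟨⟨isIdeal_inf hH hK, cooperateModulo_inf hH hK⟩, ?_⟩
  rintro M ⟨hM, hc⟩
  refine (le_iff _ _).2 fun x hx => ?_
  obtain ⟨⟨a, ha⟩, b, hb⟩ := (mem_inf _ _ _).1 hx
  rw [← cokernel_π_eq_one_iff hM]
  refine eq_one_of_cooperate hc ((mem_imageSubobject _ _).2 ⟨a, ?_⟩)
    ((mem_imageSubobject _ _).2 ⟨b, ?_⟩)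
  · rw [← ha]; rfl
  · rw [← hb]; rfl

/-! ### The Higgins commutator -/

/-- If `x` belongs to both `A` and `B`, then `ι₁ (x ⊔ 1) ⊓ ι₂ (x ⊔ 1)` belongs to the cosmash
product of `A` and `B` and is sent to `x ⊔ 1`. -/
lemma sup_one_mem_higginsCommutator {A B : Subobject X} {x : X} (hA : Mem A x) (hB : Mem B x) :
    Mem (higginsCommutator A B) (x ⊔ 1) := by
  obtain ⟨a, ha, ea⟩ := hA.exists_one_le
  obtain ⟨b, hb, eb⟩ := hB.exists_one_le
  let i₁ : (A : LGrp.{u}) ⟶ (A : LGrp.{u}) ⨿ (B : LGrp.{u}) := coprod.inl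
  let i₂ : (B : LGrp.{u}) ⟶ (A : LGrp.{u}) ⨿ (B : LGrp.{u}) := coprod.inr
  let σ := coprodToProd (A : LGrp.{u}) (B : LGrp.{u})
  have s₁ : σ (i₁ a) = prodInl _ _ a := ConcreteCategory.congr_hom (coprod.inl_desc _ _) a
  have s₂ : σ (i₂ b) = prodInr _ _ b := ConcreteCategory.congr_hom (coprod.inr_desc _ _) b
  have d₁ : coprod.desc A.arrow B.arrow (i₁ a) = A.arrow a :=
    ConcreteCategory.congr_hom (coprod.inl_desc _ _) a
  have d₂ : coprod.desc A.arrow B.arrow (i₂ b) = B.arrow b :=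
    ConcreteCategory.congr_hom (coprod.inr_desc _ _) b
  obtain ⟨k, hk⟩ := exists_kernel_ι σ (i₁ a ⊓ i₂ b)
    (by rw [LGrpHom.map_inf, s₁, s₂, prodInl_inf_prodInr ha hb])
  refine (mem_imageSubobject _ _).2 ⟨k, ?_⟩
  change coprod.desc A.arrow B.arrow (kernel.ι σ k) = x ⊔ 1
  rw [hk, LGrpHom.map_inf, d₁, d₂, ea, eb, inf_idem]

lemma mem_higginsCommutator {A B : Subobject X} {x : X} (hA : Mem A x) (hB : Mem B x) :
    Mem (higginsCommutator A B) x := by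
  -- `x` is the quotient of its positive part by its negative part.
  have e : x = (x ⊔ 1) * (x⁻¹ ⊔ 1)⁻¹ := by
    rw [eq_mul_inv_iff_mul_eq, mul_sup, mul_inv_cancel, mul_one, _root_.sup_comm]
  rw [e]
  exact (sup_one_mem_higginsCommutator hA hB).mul
    (sup_one_mem_higginsCommutator hA.inv hB.inv).inv

/-- A morphism vanishing on `A`, restricted along `A + B ⟶ X`, factors through the second
projection of `A × B`, hence vanishes on the cosmash product; and similarly for `B`. -/
lemma higginsCommutator_eq_inf {H K : Subobject X} (hH : IsIdeal H) (hK : IsIdeal K) :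
    higginsCommutator H K = H ⊓ K := by
  refine le_antisymm ((le_iff _ _).2 fun x hx => ?_) ((le_iff _ _).2 fun x hx => ?_)
  · obtain ⟨Z, f, hf⟩ := exists_mem_iff_of_isIdeal hH
    obtain ⟨Z', g, hg⟩ := exists_mem_iff_of_isIdeal hK
    obtain ⟨t, rfl⟩ := (mem_imageSubobject _ _).1 hx
    have wf : H.arrow ≫ f = 0 := hom_ext fun a => (hf _).1 ⟨a, rfl⟩
    have wg : K.arrow ≫ g = 0 := hom_ext fun a => (hg _).1 ⟨a, rfl⟩
    let σ := coprodToProd (H : LGrp.{u}) (K : LGrp.{u})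
    have σ₁ : coprod.inl ≫ σ = prod.lift (𝟙 _) 0 := coprod.inl_desc _ _
    have σ₂ : coprod.inr ≫ σ = prod.lift 0 (𝟙 _) := coprod.inr_desc _ _
    have ef : coprod.desc H.arrow K.arrow ≫ f = σ ≫ prod.snd ≫ K.arrow ≫ f := by
      refine coprod.hom_ext ?_ ?_
      · rw [← Category.assoc, coprod.inl_desc, wf, reassoc_of% σ₁, prod.lift_snd_assoc, zero_comp]
      · rw [← Category.assoc, coprod.inr_desc, reassoc_of% σ₂, prod.lift_snd_assoc,
          Category.id_comp]
    have eg : coprod.desc H.arrow K.arrow ≫ g = σ ≫ prod.fst ≫ H.arrow ≫ g := by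
      refine coprod.hom_ext ?_ ?_
      · rw [← Category.assoc, coprod.inl_desc, reassoc_of% σ₁, prod.lift_fst_assoc,
          Category.id_comp]
      · rw [← Category.assoc, coprod.inr_desc, wg, reassoc_of% σ₂, prod.lift_fst_assoc, zero_comp]
    have zf : (kernel.ι σ ≫ coprod.desc H.arrow K.arrow) ≫ f = 0 := by
      rw [Category.assoc, ef, kernel.condition_assoc, zero_comp]
    have zg : (kernel.ι σ ≫ coprod.desc H.arrow K.arrow) ≫ g = 0 := by
      rw [Category.assoc, eg, kernel.condition_assoc, zero_comp]
    rw [mem_inf, hf, hg]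
    exact ⟨ConcreteCategory.congr_hom zf t, ConcreteCategory.congr_hom zg t⟩
  · obtain ⟨h, k⟩ := (mem_inf _ _ _).1 hx
    exact mem_higginsCommutator h k

end Elements

end LGrp

theorem mainTheorem6 :
    (∀ (X : LGrp.{u}) (H K : Subobject X), IsIdeal H → IsIdeal K → IsHuqCommutator H K (H ⊓ K)) ∧
      NormalityOfHigginsCommutators LGrp.{u} := by
  refine ⟨fun X H K hH hK => LGrp.isHuqCommutator_inf hH hK, fun X H K hH hK => ?_⟩
  rw [LGrp.higginsCommutator_eq_inf hH hK]
  exact LGrp.isIdeal_inf hH hK
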